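/- Let $p$ be a prime with $p \equiv 3 \pmod 4$, let $n_1$ be a positive integer coprime to $p$, and let $m$ be the least positive integer with $p^m \equiv 1 \pmod{n_1}$. Put $q = p^m$ and $N = \frac{q-1}{n_1}$, let $\alpha$ be a primitive element of $\mathbb{F}_q$ and $\theta = \alpha^N$, and let $\mathrm{Tr}$ be the trace from $\mathbb{F}_q$ to $\mathbb{F}_p$. Consider the linear code of length $n_1$ over $\mathbb{F}_p$ \[ C_D = \{(\mathrm{Tr}(a\theta^0), \mathrm{Tr}(a\theta^1), \ldots, \mathrm{Tr}(a\theta^{n_1-1})) : a \in \mathbb{F}_q\} \] with defining set $D = \{\theta^i : 0 \le i < n_1\}$. For a linear code $C$ and $1 \le r \le \dim C$, the $r$-th generalized Hamming weight $d_r(C)$ is the minimum of $|\mathrm{Supp}(U)|$ over all $r$-dimensional subspaces $U \subseteq C$, where $\mathrm{Supp}(U)$ is the set of coordinates at which some word of $U$ is nonzero. Assume that $N_1 := \gcd\left(N, \frac{q-1}{p-1}\right) = 4$. 1. If $m \equiv 2 \pmod 4$, then for every integer $r$ with $1 \le r \le \frac{m}{2}$, \[ d_r(C_D) = \left(1 -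 \frac{1}{p^r}\right)\frac{q - 3\sqrt{q}}{N}. \] 2. If $m \equiv 0 \pmod 4$, then for every integer $r$ with $1 \le r \le \frac{m}{4}$, \[ d_r(C_D) = \left(1 - \frac{1}{p^r}\right)\frac{q - \sqrt{q}}{N}. \] -/

import Mathlib

/-- The support of a subspace `U` of `K^ι`: the set of coordinates at which some word of `U` is
nonzero. -/
def codeSupport {K ι : Type*} [Field K] (U : Submodule K (ι → K)) : Set ι :=
  {i | ∃ x ∈ U, x i ≠ 0}

/-- The `r`-th generalized Hamming weight `d_r(C)` of a linear code `C ⊆ K^ι`: the minimum of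
`|Supp(U)|` over the `r`-dimensional subspaces `U` of `C`. (The minimum is over a nonempty set of
natural numbers as soon as `r ≤ dim C`; otherwise the value is `0`.) -/
noncomputable def generalizedHammingWeight {K ι : Type*} [Field K]
    (C : Submodule K (ι → K)) (r : ℕ) : ℕ :=
  sInf {s : ℕ | ∃ U : Submodule K (ι → K),
    U ≤ C ∧ Module.finrank K U = r ∧ (codeSupport U).ncard = s}

/-- The linear map `a ↦ c(a) = (Tr(a d_i))_i` attached to a list `d` of elements of `F`. -/
noncomputable def traceWord (K : Type*) {F ι : Type*} [Field K] [Field F] [Algebra K F]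
    (d : ι → F) : F →ₗ[K] (ι → K) where
  toFun a := fun i => Algebra.trace K F (a * d i)
  map_add' a b := by
    funext i
    simp [add_mul]
  map_smul' c a := by
    funext i
    simp

/-- The linear code `C_D = {c(a) : a ∈ F}` with defining set `D = {d_i}`. -/
noncomputable def definingSetCode (K : Type*) {F ι : Type*} [Field K] [Field F] [Algebra K F]
    (d : ι → F) : Submodule K (ι → K) :=
  LinearMap.range (traceWord K d)

/-! ### Sums over cyclic groups -/

/-! Since `θ` generates `F` over the prime field, `a ↦ c(a)` is injective, and an `r`-dimensional
subcode is the image of an `r`-dimensional `H ⊆ F`. Write `S(a) = ∑ x, ψ (a x ^ 4)` with `ψ` the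
canonical character. Orthogonality, and the replacement of `N`-th powers by powers of exponent `N₁ =
4`, give `N p^r |Supp| = p^r q - ∑_{a ∈ H} S(a)` (`mul_card_mul_ncard_codeSupport`). As `S(0) = q`,
the weight is least when `S` attains its maximum `B` on all of `H \ {0}`, and is then `(1 -
p^{-r})(q - B)/N`.

For `m = 2h`, put `ε = (-p)^h`. On the four cosets of fourth powers `S` equals `ε` three times and
`-3ε` once (`quarticSum_values`), so `B = 3√q` for odd `h` and `B = √q` for even `h`.

The maximum is attained on a multiple `cK` of a subfield `K` whose nonzero elements are all fourth
powers in `F` (`exists_submodule_subset_coset_pow_four`): `|K| = p^{m/2}` for odd `h`, `|K| =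
p^{m/4}` for even `h`. This is the range of `r`. -/

theorem sum_range_mul_of_periodic {M : Type*} [AddCommMonoid M] {f : ℕ → M} {c : ℕ}
    (hf : Function.Periodic f c) (k : ℕ) :
    ∑ i ∈ Finset.range (c * k), f i = k • ∑ i ∈ Finset.range c, f i := by
  induction k with
  | zero => simp
  | succ k ih =>
    rw [Nat.mul_succ, Finset.sum_range_add, ih, succ_nsmul]
    congr 1
    refine Finset.sum_congr rfl fun i _ => ?_
    rw [add_comm, mul_comm]
    simpa using hf.nat_mul k i

theorem sum_eq_sum_range_pow {G M : Type*} [Group G] [Fintype G] [AddCommMonoid M] {α : G}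
    (hα : ∀ x, x ∈ Subgroup.zpowers α) (f : G → M) :
    ∑ u, f u = ∑ i ∈ Finset.range (Fintype.card G), f (α ^ i) := by
  classical
  rw [← Nat.card_eq_fintype_card, ← IsCyclic.image_range_card hα, Finset.sum_image]
  rw [← orderOf_eq_card_of_forall_mem_zpowers hα, Finset.coe_range]
  exact pow_injOn_Iio_orderOf

/-- Averaging over the powers of exponents `k` and `l` is averaging over the powers of exponent
`gcd k l`. -/
theorem sum_sum_pow_mul_pow {G M : Type*} [CommGroup G] [Fintype G] [AddCommMonoid M]
    [IsAddTorsionFree M] (k l : ℕ) (f : G → M) :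
    ∑ z, ∑ x, f (z ^ k * x ^ l) = Fintype.card G • ∑ w, f (w ^ Nat.gcd k l) := by
  -- By Bézout, `w ^ gcd k l` is a `k`-th power times an `l`-th power, absorbed by translating `z`
  -- and `x`. Conversely `z ^ k * x ^ l` is a `gcd`-th power, absorbed by translating `w`. The
  -- triple sum is then evaluated in both ways.
  have hshift (w : G) : ∑ z, ∑ x, f (z ^ k * x ^ l * w ^ Nat.gcd k l)
      = ∑ z, ∑ x, f (z ^ k * x ^ l) := by
    have hw : w ^ Nat.gcd k l = (w ^ Nat.gcdA k l) ^ k * (w ^ Nat.gcdB k l) ^ l := by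
      simp only [← zpow_natCast]
      rw [Nat.gcd_eq_gcd_ab, zpow_add, ← zpow_mul, ← zpow_mul, mul_comm (k : ℤ), mul_comm (l : ℤ)]
    rw [← Equiv.sum_comp (Equiv.mulRight (w ^ Nat.gcdA k l)) fun z => ∑ x, f (z ^ k * x ^ l)]
    refine Finset.sum_congr rfl fun z _ => ?_
    rw [← Equiv.sum_comp (Equiv.mulRight (w ^ Nat.gcdB k l))
      fun x => f (Equiv.mulRight (w ^ Nat.gcdA k l) z ^ k * x ^ l)]
    refine Finset.sum_congr rfl fun x _ => ?_
    simp only [Equiv.coe_mulRight]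
    rw [hw, mul_pow, mul_pow, mul_mul_mul_comm]
  have hinner (z x : G) : ∑ w, f (z ^ k * x ^ l * w ^ Nat.gcd k l)
      = ∑ w, f (w ^ Nat.gcd k l) := by
    obtain ⟨k', hk⟩ := Nat.gcd_dvd_left k l
    obtain ⟨l', hl⟩ := Nat.gcd_dvd_right k l
    rw [← Equiv.sum_comp (Equiv.mulLeft (z ^ k' * x ^ l')) fun w => f (w ^ Nat.gcd k l)]
    refine Finset.sum_congr rfl fun w _ => ?_
    simp only [Equiv.coe_mulLeft]
    rw [mul_pow, mul_pow, ← pow_mul, ← pow_mul, mul_comm k', mul_comm l', ← hk, ← hl]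
  have key : Fintype.card G • ∑ z, ∑ x, f (z ^ k * x ^ l)
      = Fintype.card G • (Fintype.card G • ∑ w, f (w ^ Nat.gcd k l)) := by
    calc Fintype.card G • ∑ z, ∑ x, f (z ^ k * x ^ l)
        = ∑ w, ∑ z, ∑ x, f (z ^ k * x ^ l * w ^ Nat.gcd k l) := by
          simp [hshift]
      _ = ∑ z, ∑ x, ∑ w, f (z ^ k * x ^ l * w ^ Nat.gcd k l) := by
          rw [Finset.sum_comm]
          exact Finset.sum_congr rfl fun z _ => Finset.sum_comm
      _ = _ := by simp [hinner]
  exact nsmul_right_injective Fintype.card_ne_zero key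

/-! ### Quartic exponential sums -/

section QuarticSum

/-- The exponential sum `∑ x, ψ (a x ^ 4)`. -/
noncomputable def quarticSum {F : Type*} [Field F] [Fintype F] (ψ : AddChar F ℂ) (a : F) : ℂ :=
  ∑ x, ψ (a * x ^ 4)

variable {F : Type*} [Field F] [Fintype F] {ψ : AddChar F ℂ}

theorem sum_eq_zero_add_sum_units [Fintype Fˣ] {M : Type*} [AddCommMonoid M] (f : F → M) :
    ∑ x, f x = f 0 + ∑ u : Fˣ, f u := by
  classical
  rw [Fintype.sum_eq_add_sum_compl 0]
  congr 1
  rw [Finset.sum_subtype (p := fun x : F => x ≠ 0) _ (by simp) f]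
  exact (Fintype.sum_equiv unitsEquivNeZero _ _ fun _ => rfl).symm

theorem quarticSum_zero : quarticSum ψ 0 = Fintype.card F := by
  simp [quarticSum]

theorem quarticSum_mul_pow_four (a : F) {y : F} (hy : y ≠ 0) :
    quarticSum ψ (a * y ^ 4) = quarticSum ψ a := by
  unfold quarticSum
  rw [← Equiv.sum_comp (Equiv.mulLeft₀ y hy) fun x => ψ (a * x ^ 4)]
  refine Finset.sum_congr rfl fun x _ => ?_
  simp [mul_pow, mul_assoc]

theorem quarticSum_eq_one_add [Fintype Fˣ] (a : F) :
    quarticSum ψ a = 1 + ∑ u : Fˣ, ψ (a * (u : F) ^ 4) := by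
  rw [quarticSum, sum_eq_zero_add_sum_units]
  simp

theorem quarticSum_pow (p : ℕ) [Fact p.Prime] [CharP F p] (hψ : ∀ x, ψ (x ^ p) = ψ x) (a : F) :
    quarticSum ψ (a ^ p) = quarticSum ψ a := by
  unfold quarticSum
  rw [← Equiv.sum_comp (frobeniusEquiv F p).toEquiv]
  refine Finset.sum_congr rfl fun x _ => ?_
  rw [← hψ (a * x ^ 4)]
  congr 1
  simp [frobeniusEquiv_apply, frobenius_def, mul_pow, ← pow_mul, mul_comm]

theorem sum_quarticSum (hψ : ψ.IsPrimitive) : ∑ a, quarticSum ψ a = Fintype.card F := by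
  classical
  simp only [quarticSum]
  rw [Finset.sum_comm]
  simp [AddChar.sum_mulShift _ hψ]

/-- Orthogonality counts the zeros of `x ^ 4 + g y ^ 4`; the hypothesis on `g` leaves only the
trivial one. -/
theorem sum_quarticSum_mul (hψ : ψ.IsPrimitive) {g : F} (hg : ∀ z, z ^ 4 ≠ -g) :
    ∑ a, quarticSum ψ a * quarticSum ψ (g * a) = Fintype.card F := by
  classical
  have hzero (x y : F) : x ^ 4 + g * y ^ 4 = 0 ↔ x = 0 ∧ y = 0 := by
    constructor
    · intro h
      by_cases hy : y = 0
      · subst hy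
        simpa using h
      · refine absurd ?_ (hg (x / y))
        rw [div_pow, div_eq_iff (by positivity)]
        linear_combination h
    · rintro ⟨rfl, rfl⟩
      simp
  have hexp (a : F) : quarticSum ψ a * quarticSum ψ (g * a)
      = ∑ x, ∑ y, ψ (a * (x ^ 4 + g * y ^ 4)) := by
    rw [quarticSum, quarticSum, Finset.sum_mul_sum]
    refine Finset.sum_congr rfl fun x _ => Finset.sum_congr rfl fun y _ => ?_
    rw [← AddChar.map_add_eq_mul]
    congr 1
    ring
  simp only [hexp]
  rw [Finset.sum_comm]
  simp only [Finset.sum_comm (s := Finset.univ (α := F)) (f := fun a y => ψ (a * (_ + g * y ^ 4))),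
    AddChar.sum_mulShift _ hψ, hzero]
  simp [ite_and]

end QuarticSum

theorem eq_of_pow_mod_four {F : Type*} [Field F] {α : Fˣ} {f : F → ℂ}
    (hf : ∀ a y : F, y ≠ 0 → f (a * y ^ 4) = f a) (k : ℕ) :
    f ((α : F) ^ k) = f ((α : F) ^ (k % 4)) := by
  conv_lhs => rw [← Nat.mod_add_div k 4, pow_add, mul_comm 4, pow_mul]
  exact hf _ _ (pow_ne_zero _ α.ne_zero)

theorem sum_units_of_mul_pow_four {F : Type*} [Field F] [Fintype Fˣ] {α : Fˣ} (hα : ∀ x, x ∈ Subgroup.zpowers α)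
    {c : ℕ} (hc : Fintype.card Fˣ = 4 * c) {f : F → ℂ}
    (hf : ∀ a y : F, y ≠ 0 → f (a * y ^ 4) = f a) :
    ∑ u : Fˣ, f u
      = c * (f 1 + f α + f ((α : F) ^ 2) + f ((α : F) ^ 3)) := by
  have hper : Function.Periodic (fun i : ℕ => f ((α ^ i : Fˣ) : F)) 4 := fun i => by
    simpa [pow_add] using hf ((α : F) ^ i) α α.ne_zero
  rw [sum_eq_sum_range_pow hα, hc, sum_range_mul_of_periodic hper]
  simp [Finset.sum_range_succ]
  ring

/-! ### Evaluation of the quartic sums -/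

section QuarticSumValues

variable {F : Type*} [Field F] [Fintype F] {ψ : AddChar F ℂ}

theorem pow_ne_neg_pow_four [Fintype Fˣ] {α : Fˣ} (hα : ∀ x, x ∈ Subgroup.zpowers α)
    {c : ℕ} (hc : Fintype.card Fˣ = 8 * c) {k : ℕ} (hk : ¬ 4 ∣ k) (z : F) :
    z ^ 4 ≠ -(α : F) ^ k := by
  intro h
  have hz : z ≠ 0 := by
    rintro rfl
    simp at h
  obtain ⟨j, hj⟩ := (mem_powers_iff_mem_zpowers.mpr (hα (Units.mk0 z hz)) :
    Units.mk0 z hz ∈ Submonoid.powers α)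
  have hj' : z = (α : F) ^ j := by
    simpa using (congrArg Units.val hj).symm
  have hord : orderOf α = 8 * c := by
    rw [orderOf_eq_card_of_forall_mem_zpowers hα, Nat.card_eq_fintype_card, hc]
  -- Squaring removes the sign; comparing exponents modulo `8` then forces `4 ∣ k`.
  have h2 : α ^ (8 * j) = α ^ (2 * k) := by
    ext
    push_cast
    calc (α : F) ^ (8 * j) = (z ^ 4) ^ 2 := by rw [hj']; ring
      _ = (α : F) ^ (2 * k) := by rw [h]; ring
  rw [pow_eq_pow_iff_modEq, hord] at h2
  have h3 : 8 * j ≡ 2 * k [MOD 8] := h2.of_mul_right c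
  unfold Nat.ModEq at h3
  omega

/-- The values of the quartic exponential sum when `p ≡ 3 mod 4`, up to a common sign. -/
theorem quarticSum_relations [Fintype Fˣ] (p : ℕ) [Fact p.Prime] [CharP F p] (hp : p % 4 = 3)
    (hψ : ψ.IsPrimitive) (hψp : ∀ x, ψ (x ^ p) = ψ x) {α : Fˣ}
    (hα : ∀ x, x ∈ Subgroup.zpowers α) (hcard : 8 ∣ Fintype.card Fˣ) :
    quarticSum ψ ((α : F) ^ 3) = quarticSum ψ α ∧
    quarticSum ψ (α : F) ^ 2 = Fintype.card F ∧
    quarticSum ψ 1 + quarticSum ψ ((α : F) ^ 2) = -2 * quarticSum ψ α ∧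
    quarticSum ψ 1 * quarticSum ψ ((α : F) ^ 2) = -3 * Fintype.card F := by
  obtain ⟨c, hc⟩ := hcard
  have hc0 : (c : ℂ) ≠ 0 := by
    rintro h
    rw [Nat.cast_eq_zero] at h
    simp [h] at hc
  have hc4 : Fintype.card Fˣ = 4 * (2 * c) := by rw [hc]; ring
  have hF : (Fintype.card F : ℂ) = 8 * c + 1 := by
    have h1 : Fintype.card F = Fintype.card Fˣ + 1 := by
      rw [← Nat.card_eq_fintype_card, ← Nat.card_eq_fintype_card,
        Nat.card_eq_card_units_add_one]
    rw [h1, hc]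
    push_cast
    ring
  have hsum := sum_quarticSum hψ
  have hsum1 := sum_quarticSum_mul hψ (g := (α : F))
    (by simpa using pow_ne_neg_pow_four hα hc (k := 1) (by norm_num))
  have hsum2 := sum_quarticSum_mul hψ (g := (α : F) ^ 2)
    (pow_ne_neg_pow_four hα hc (k := 2) (by norm_num))
  have hzero := quarticSum_zero (ψ := ψ)
  have hinv (a y : F) (hy : y ≠ 0) := quarticSum_mul_pow_four (ψ := ψ) a hy
  have hfrob := quarticSum_pow p hψp (α : F)
  generalize quarticSum ψ = S at *
  have hinv2 (g a y : F) (hy : y ≠ 0) :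
      S (a * y ^ 4) * S (g * (a * y ^ 4)) = S a * S (g * a) := by
    rw [← mul_assoc, hinv _ _ hy, hinv _ _ hy]
  have h4 : S ((α : F) ^ 4) = S 1 := by
    simpa using eq_of_pow_mod_four (α := α) hinv 4
  have h5 : S ((α : F) ^ 5) = S α := by
    simpa using eq_of_pow_mod_four (α := α) hinv 5
  -- Frobenius invariance identifies the cosets of `α` and `α ^ p`, and `p ≡ 3` modulo `4`.
  have h3 : S ((α : F) ^ 3) = S α := by
    rw [← hfrob, eq_of_pow_mod_four hinv p, hp]
  rw [sum_eq_zero_add_sum_units, hzero, sum_units_of_mul_pow_four hα hc4 hinv, h3] at hsum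
  rw [sum_eq_zero_add_sum_units, mul_zero, hzero,
    sum_units_of_mul_pow_four (f := fun a => S a * S (α * a)) hα hc4 (hinv2 α)] at hsum1
  rw [sum_eq_zero_add_sum_units, mul_zero, hzero,
    sum_units_of_mul_pow_four (f := fun a => S a * S ((α : F) ^ 2 * a)) hα hc4
      (hinv2 _)] at hsum2
  simp only [mul_one, ← pow_succ', ← pow_succ, ← pow_add, ← pow_mul, Nat.reduceAdd, Nat.reducePow,
    ← pow_two, h3, h4, h5]
    at hsum1 hsum2
  push_cast at hsum hsum1 hsum2
  rw [hF] at hsum hsum1 hsum2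
  -- The three identities come from the total sum of `S` and its correlations with shifts by `α` and
  -- `α ^ 2`, using `q - 1 = 8c`.
  have e1 : S 1 + S ((α : F) ^ 2) = -2 * S α := by
    apply mul_left_cancel₀ hc0
    linear_combination hsum / 2
  have e2 : S α ^ 2 = Fintype.card F := by
    rw [hF]
    apply mul_left_cancel₀ hc0
    linear_combination -hsum1 / 8 + c * S α / 2 * e1
  refine ⟨h3, e2, e1, ?_⟩
  rw [hF] at e2 ⊢
  apply mul_left_cancel₀ hc0
  linear_combination hsum2 / 4 - c * e2

theorem AddChar.isIntegral_apply (x : F) : IsIntegral ℤ (ψ x) := by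
  refine IsIntegral.of_pow (n := ringChar F) (CharP.char_ne_zero_of_finite F _).bot_lt ?_
  rw [← AddChar.map_nsmul_eq_pow, nsmul_eq_mul, ringChar.Nat.cast_ringChar, zero_mul,
    AddChar.map_zero_eq_one]
  exact isIntegral_one

/-- The map `u ↦ u ^ 4` is four-to-one on units, so the sum is `1 + 4η` with `η` an algebraic
integer; a rational `η` is an integer. -/
theorem four_dvd_sub_one_of_quarticSum_eq [Fintype Fˣ] {α : Fˣ}
    (hα : ∀ x, x ∈ Subgroup.zpowers α) (hcard : 4 ∣ Fintype.card Fˣ) {a : F} {s : ℤ}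
    (hs : quarticSum ψ a = s) : 4 ∣ s - 1 := by
  obtain ⟨c, hc⟩ := hcard
  have hper : Function.Periodic (fun i : ℕ => ψ (a * ((α ^ i : Fˣ) : F) ^ 4)) c := fun i => by
    have : (α : F) ^ (c * 4) = 1 := by
      rw [mul_comm, ← hc]
      rw [← Units.val_pow_eq_pow_val, pow_card_eq_one, Units.val_one]
    simp [pow_add, mul_pow, ← pow_mul, this]
  rw [quarticSum_eq_one_add, sum_eq_sum_range_pow hα (fun u : Fˣ => ψ (a * (u : F) ^ 4)), hc,
    mul_comm, sum_range_mul_of_periodic hper] at hs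
  set η := ∑ i ∈ Finset.range c, ψ (a * ((α ^ i : Fˣ) : F) ^ 4)
  have hη : IsIntegral ℤ η := IsIntegral.sum _ fun i _ => AddChar.isIntegral_apply _
  have hη' : η = algebraMap ℚ ℂ ((s - 1) / 4) := by
    simp at hs ⊢
    linear_combination hs / 4
  rw [hη', isIntegral_algebraMap_iff (algebraMap ℚ ℂ).injective,
    IsIntegrallyClosed.isIntegral_iff] at hη
  obtain ⟨t, ht⟩ := hη
  refine ⟨t, ?_⟩
  have : ((s - 1 : ℤ) : ℚ) = ((4 * t : ℤ) : ℚ) := by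
    push_cast
    simp at ht
    linear_combination -4 * ht
  exact_mod_cast this

/-- The values of the quartic exponential sum in the semiprimitive case. -/
theorem quarticSum_values [Fintype Fˣ] (p : ℕ) [Fact p.Prime] [CharP F p] (hp : p % 4 = 3)
    (hψ : ψ.IsPrimitive) (hψp : ∀ x, ψ (x ^ p) = ψ x) {α : Fˣ}
    (hα : ∀ x, x ∈ Subgroup.zpowers α) (hcard : 8 ∣ Fintype.card Fˣ) {h : ℕ}
    (hF : Fintype.card F = p ^ (2 * h)) :
    quarticSum ψ (α : F) = ((-p : ℤ) ^ h : ℤ) ∧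
    (∃ c : F, c ≠ 0 ∧ quarticSum ψ c = (-3 * (-p : ℤ) ^ h : ℤ)) ∧
    ∀ a : F, a ≠ 0 → quarticSum ψ a = ((-p : ℤ) ^ h : ℤ) ∨
      quarticSum ψ a = (-3 * (-p : ℤ) ^ h : ℤ) := by
  obtain ⟨e3, e1, e02, e0⟩ := quarticSum_relations p hp hψ hψp hα hcard
  have hsq : (Fintype.card F : ℂ) = (((-p : ℤ) ^ h : ℤ) : ℂ) ^ 2 := by
    rw [hF]
    push_cast
    rw [← pow_mul, mul_comm h, Even.neg_pow (even_two_mul h)]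
  -- The sign of the square root is fixed modulo `4`: `(-p)^h ≡ 1`, so its negative cannot be a
  -- quartic sum.
  have hmod : ((-p : ℤ) ^ h) % 4 = 1 := by
    have : (-p : ℤ) ^ h ≡ 1 ^ h [ZMOD 4] := Int.ModEq.pow h (by unfold Int.ModEq; omega)
    simpa [Int.ModEq] using this
  have hS1 : quarticSum ψ (α : F) = ((-p : ℤ) ^ h : ℤ) := by
    rw [hsq, sq_eq_sq_iff_eq_or_eq_neg] at e1
    rcases e1 with e1 | e1
    · exact e1
    · rw [← Int.cast_neg] at e1
      have := four_dvd_sub_one_of_quarticSum_eq hα (dvd_trans (by norm_num) hcard) e1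
      omega
  rw [hsq, ← hS1] at e0
  -- `S(1)` and `S(α ^ 2)` are the roots of `T² + 2εT - 3ε² = (T - ε)(T + 3ε)`, where `ε = S(α)`.
  have hprod : (quarticSum ψ 1 - quarticSum ψ (α : F)) *
      (quarticSum ψ 1 + 3 * quarticSum ψ (α : F)) = 0 := by
    linear_combination quarticSum ψ 1 * e02 - e0
  have hcases : (quarticSum ψ 1 = quarticSum ψ (α : F) ∧
      quarticSum ψ ((α : F) ^ 2) = -3 * quarticSum ψ (α : F)) ∨
      (quarticSum ψ 1 = -3 * quarticSum ψ (α : F) ∧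
      quarticSum ψ ((α : F) ^ 2) = quarticSum ψ (α : F)) := by
    rcases mul_eq_zero.mp hprod with h0 | h0
    · exact Or.inl ⟨by linear_combination h0, by linear_combination e02 - h0⟩
    · exact Or.inr ⟨by linear_combination h0, by linear_combination e02 - h0⟩
  rw [Int.cast_mul, ← hS1]
  push_cast
  refine ⟨rfl, ?_, fun a ha => ?_⟩
  · rcases hcases with h | h
    · exact ⟨_, pow_ne_zero 2 α.ne_zero, h.2⟩
    · exact ⟨1, one_ne_zero, h.1⟩
  · obtain ⟨j, hj⟩ := (mem_powers_iff_mem_zpowers.mpr (hα (Units.mk0 a ha)) :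
      Units.mk0 a ha ∈ Submonoid.powers α)
    have hj' : a = (α : F) ^ j := by
      simpa using (congrArg Units.val hj).symm
    rw [hj', eq_of_pow_mod_four fun _ _ => quarticSum_mul_pow_four _]
    have : j % 4 < 4 := Nat.mod_lt _ (by norm_num)
    interval_cases j % 4
    · rw [pow_zero]; tauto
    · rw [pow_one]; tauto
    · tauto
    · tauto

end QuarticSumValues

/-! ### The trace character and reduction of the exponent to a gcd -/

section TraceCharacter

/-- The canonical additive character `x ↦ exp (2 π i Tr x / p)` of a finite field. -/
noncomputable def traceChar (p : ℕ) [NeZero p] (F : Type*) [Field F] [Algebra (ZMod p) F] :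
    AddChar F ℂ :=
  (ZMod.stdAddChar (N := p)).compAddMonoidHom (Algebra.trace (ZMod p) F).toAddMonoidHom

variable {p : ℕ} [Fact p.Prime] {F : Type*} [Field F] [Algebra (ZMod p) F]

theorem traceChar_apply (x : F) :
    traceChar p F x = ZMod.stdAddChar (Algebra.trace (ZMod p) F x) := rfl

theorem traceChar_eq_one_iff (x : F) : traceChar p F x = 1 ↔ Algebra.trace (ZMod p) F x = 0 := by
  rw [traceChar_apply, ← AddChar.map_zero_eq_one (ZMod.stdAddChar (N := p)),
    ZMod.injective_stdAddChar.eq_iff]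

theorem sum_traceChar_mul (H : Submodule (ZMod p) F) [Fintype H] (x : F)
    [Decidable (∀ a ∈ H, Algebra.trace (ZMod p) F (a * x) = 0)] :
    ∑ a : H, traceChar p F (a * x)
      = if ∀ a ∈ H, Algebra.trace (ZMod p) F (a * x) = 0 then (Fintype.card H : ℂ) else 0 := by
  classical
  let χ : AddChar H ℂ := (traceChar p F).compAddMonoidHom
    ((AddMonoidHom.mulRight x).comp H.subtype.toAddMonoidHom)
  have hχa (a : H) : χ a = traceChar p F (a * x) := rfl
  have hχ : χ = 0 ↔ ∀ a ∈ H, Algebra.trace (ZMod p) F (a * x) = 0 := by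
    rw [AddChar.eq_zero_iff]
    simp only [Subtype.forall, hχa, traceChar_eq_one_iff]
  simp only [← hχa, ← hχ]
  exact AddChar.sum_eq_ite χ

variable [Fintype F]

theorem traceChar_isPrimitive : (traceChar p F).IsPrimitive := by
  refine AddChar.IsPrimitive.of_ne_one fun h => ?_
  obtain ⟨x, hx⟩ := Algebra.trace_surjective (ZMod p) F 1
  have := (traceChar_eq_one_iff (p := p) x).mp (by rw [h]; rfl)
  exact one_ne_zero (hx.symm.trans this)

theorem traceChar_pow (x : F) : traceChar p F (x ^ p) = traceChar p F x := by
  have h := Algebra.trace_eq_of_algEquiv (FiniteField.frobeniusAlgEquivOfAlgebraic (ZMod p) F) x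
  rw [FiniteField.coe_frobeniusAlgEquivOfAlgebraic, ZMod.card] at h
  rw [traceChar_apply, traceChar_apply, h]

/-- With `l = (q - 1)/(p - 1)`, every `z ^ l` is the norm of `z`, a nonzero scalar preserving `H`.
Averaging over such scalars turns `u ^ k` into `u ^ k * z ^ l`, to which `sum_sum_pow_mul_pow`
applies. -/
theorem sum_sum_traceChar_mul_pow [Fintype Fˣ] (H : Submodule (ZMod p) F) [Fintype H] (k : ℕ) :
    ∑ a : H, ∑ u : Fˣ, traceChar p F (a * (u : F) ^ k)
      = ∑ a : H, ∑ u : Fˣ,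
        traceChar p F (a * (u : F) ^ Nat.gcd k ((Fintype.card F - 1) / (p - 1))) := by
  set l := (Fintype.card F - 1) / (p - 1)
  have hscalar (z : Fˣ) (f : F → ℂ) : ∑ a : H, f (a * (z : F) ^ l) = ∑ a : H, f a := by
    let c : (ZMod p)ˣ := Units.map (Algebra.norm (ZMod p)) z
    have hc : algebraMap (ZMod p) F c = (z : F) ^ l := by
      have := FiniteField.algebraMap_norm_eq_pow (K := ZMod p) (x := (z : F))
      rw [Nat.card_eq_fintype_card, Nat.card_eq_fintype_card, ZMod.card] at this
      exact this
    rw [← Equiv.sum_comp (MulAction.toPerm (α := (ZMod p)ˣ) (β := H) c) fun a : H => f a]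
    refine Finset.sum_congr rfl fun a _ => ?_
    rw [← hc, mul_comm, ← Algebra.smul_def]
    rfl
  have key : (Fintype.card Fˣ : ℂ) * ∑ a : H, ∑ u : Fˣ, traceChar p F (a * (u : F) ^ k)
      = Fintype.card Fˣ * ∑ a : H, ∑ u : Fˣ, traceChar p F (a * (u : F) ^ Nat.gcd k l) := by
    calc (Fintype.card Fˣ : ℂ) * ∑ a : H, ∑ u : Fˣ, traceChar p F (a * (u : F) ^ k)
        = ∑ z : Fˣ, ∑ a : H, ∑ u : Fˣ, traceChar p F (a * (z : F) ^ l * (u : F) ^ k) := by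
          rw [Finset.sum_congr rfl fun z _ =>
            hscalar z fun a => ∑ u : Fˣ, traceChar p F (a * (u : F) ^ k)]
          simp
      _ = ∑ a : H, ∑ u : Fˣ, ∑ z : Fˣ, traceChar p F (a * ((u ^ k * z ^ l : Fˣ) : F)) := by
          rw [Finset.sum_comm]
          refine Finset.sum_congr rfl fun a _ => ?_
          rw [Finset.sum_comm]
          refine Finset.sum_congr rfl fun u _ => Finset.sum_congr rfl fun z _ => ?_
          congr 1
          push_cast
          ring
      _ = _ := by
          rw [Finset.mul_sum]
          refine Finset.sum_congr rfl fun a _ => ?_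
          rw [sum_sum_pow_mul_pow k l fun u : Fˣ => traceChar p F (a * (u : F))]
          simp
  exact mul_left_cancel₀ (Nat.cast_ne_zero.mpr Fintype.card_ne_zero) key

end TraceCharacter

/-! ### Support weights as character sums -/

section Weight

theorem codeSupport_map_traceWord {K F ι : Type*} [Field K] [Field F] [Algebra K F] (d : ι → F)
    (H : Submodule K F) :
    codeSupport (H.map (traceWord K d)) = {i | ∃ a ∈ H, Algebra.trace K F (a * d i) ≠ 0} := by
  ext i
  simp [codeSupport, traceWord]

variable {p : ℕ} [Fact p.Prime] {F : Type*} [Field F] [Algebra (ZMod p) F] [Fintype F]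

/-- At each coordinate the character sum over `H` is `|H|` off the support and `0` on it. -/
theorem card_mul_ncard_codeSupport {ι : Type*} [Fintype ι] (d : ι → F) (H : Submodule (ZMod p) F)
    [Fintype H] :
    (Fintype.card H : ℂ) * (codeSupport (H.map (traceWord (ZMod p) d))).ncard
      = Fintype.card H * Fintype.card ι - ∑ a : H, ∑ i, traceChar p F (a * d i) := by
  classical
  rw [Finset.sum_comm]
  simp only [sum_traceChar_mul]
  rw [codeSupport_map_traceWord, Set.ncard_eq_toFinset_card', Set.toFinset_ofPred,
    ← Finset.card_univ (α := ι), ← Finset.card_filter_add_card_filter_not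
      (s := Finset.univ (α := ι)) fun i => ∃ a ∈ H, Algebra.trace (ZMod p) F (a * d i) ≠ 0]
  push Not
  rw [← Finset.sum_filter, Finset.sum_const]
  push_cast
  rw [nsmul_eq_mul]
  ring

/-- The support weight of a subcode of an irreducible cyclic code, in terms of quartic exponential
sums. -/
theorem mul_card_mul_ncard_codeSupport {N n : ℕ} {α : Fˣ} (hα : ∀ x, x ∈ Subgroup.zpowers α)
    (hN : N * n = Fintype.card F - 1)
    (hgcd : Nat.gcd N ((Fintype.card F - 1) / (p - 1)) = 4) (H : Submodule (ZMod p) F) [Fintype H] :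
    (N : ℂ) * (Fintype.card H * (codeSupport (H.map
        (traceWord (ZMod p) fun i : Fin n => ((α : F) ^ N) ^ (i : ℕ)))).ncard)
      = Fintype.card H * Fintype.card F - ∑ a : H, quarticSum (traceChar p F) a := by
  classical
  have hcard : Fintype.card Fˣ = n * N := by
    rw [Fintype.card_units, ← hN, mul_comm]
  have hcardF : (Fintype.card F : ℂ) = N * n + 1 := by
    rw [Fintype.card_eq_card_units_add_one, hcard]
    push_cast
    ring
  have hα1 : (α : F) ^ (N * n) = 1 := by
    rw [mul_comm, ← hcard, ← Units.val_pow_eq_pow_val, pow_card_eq_one, Units.val_one]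
  -- The `N`-th power map on the cyclic group of order `N * n` hits each power of `α ^ N` exactly
  -- `N` times.
  have hperiod (a : F) : N * ∑ i : Fin n, traceChar p F (a * ((α : F) ^ N) ^ (i : ℕ))
      = ∑ u : Fˣ, traceChar p F (a * (u : F) ^ N) := by
    have hper : Function.Periodic (fun i : ℕ => traceChar p F (a * ((α ^ i : Fˣ) : F) ^ N)) n := by
      intro i
      simp [pow_add, mul_pow, ← pow_mul, mul_comm n, hα1]
    rw [sum_eq_sum_range_pow hα fun u : Fˣ => traceChar p F (a * (u : F) ^ N), hcard,
      sum_range_mul_of_periodic hper, nsmul_eq_mul,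
      Fin.sum_univ_eq_sum_range fun i => traceChar p F (a * ((α : F) ^ N) ^ i)]
    simp [← pow_mul, mul_comm N]
  rw [card_mul_ncard_codeSupport, mul_sub, Finset.mul_sum]
  simp only [hperiod]
  rw [sum_sum_traceChar_mul_pow, hgcd, Fintype.card_fin, hcardF]
  simp only [quarticSum_eq_one_add, Finset.sum_add_distrib]
  simp
  ring

end Weight

/-! ### Subspaces inside cosets of fourth powers, and injectivity of the encoding -/

section Dimension

theorem Submodule.exists_le_finrank_eq {K V : Type*} [Field K] [AddCommGroup V] [Module K V]
    (W : Submodule K V) {r : ℕ} (hr : r ≤ Module.finrank K W) :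
    ∃ H ≤ W, Module.finrank K H = r := by
  obtain ⟨s, hs, hli⟩ := exists_finset_linearIndependent_of_le_finrank hr
  refine ⟨(Submodule.span K (s : Set W)).map W.subtype, Submodule.map_subtype_le _ _, ?_⟩
  rw [← (Submodule.equivMapOfInjective _ W.injective_subtype _).finrank_eq,
    finrank_span_finset_eq_card hli, hs]

variable {p : ℕ} [Fact p.Prime] {F : Type*} [Field F] [Algebra (ZMod p) F] [Fintype F]

theorem finrank_eq_of_card_eq {m : ℕ} (hF : Fintype.card F = p ^ m) :
    Module.finrank (ZMod p) F = m := by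
  rw [Module.card_eq_pow_finrank (K := ZMod p), ZMod.card] at hF
  exact Nat.pow_right_injective (Fact.out : p.Prime).two_le hF

/-- Inside a coset of the fourth powers there are subspaces, punctured at zero, of every dimension
up to that of a subfield all of whose elements are fourth powers. -/
theorem exists_submodule_subset_coset_pow_four {m k r : ℕ} (hF : Fintype.card F = p ^ m)
    (hk : 0 < k) (hkm : k ∣ m) (hdvd : 4 * (p ^ k - 1) ∣ p ^ m - 1) {α : Fˣ}
    (hα : ∀ x, x ∈ Subgroup.zpowers α) {c : F} (hc : c ≠ 0) (hr : r ≤ k) :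
    ∃ H : Submodule (ZMod p) F, Module.finrank (ZMod p) H = r ∧
      ∀ a ∈ H, a ≠ 0 → ∃ y, y ≠ 0 ∧ a = c * y ^ 4 := by
  classical
  have hp := (Fact.out : p.Prime)
  have hkm' : Module.finrank (ZMod p) (GaloisField p k) ∣ Module.finrank (ZMod p) F := by
    rwa [GaloisField.finrank p hk.ne', finrank_eq_of_card_eq hF]
  obtain ⟨f⟩ := FiniteField.nonempty_algHom_of_finrank_dvd hkm'
  let g : GaloisField p k →ₗ[ZMod p] F := (LinearMap.mulLeft (ZMod p) c).comp f.toLinearMap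
  have hg : Function.Injective g := (mul_right_injective₀ hc).comp f.injective
  obtain ⟨H, hH, hrank⟩ := (LinearMap.range g).exists_le_finrank_eq (r := r) (by
    rwa [LinearMap.finrank_range_of_inj hg, GaloisField.finrank p hk.ne'])
  refine ⟨H, hrank, fun a ha ha0 => ?_⟩
  obtain ⟨x, rfl⟩ := hH ha
  have hgx : g x = c * f x := rfl
  rw [hgx] at ha0 ⊢
  have hfx : f x ≠ 0 := right_ne_zero_of_mul ha0
  have hx : x ≠ 0 := by
    rintro rfl
    exact hfx (map_zero f)
  have hpow : f x ^ (p ^ k - 1) = 1 := by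
    have := Fintype.ofFinite (GaloisField p k)
    rw [← map_pow, ← GaloisField.card p k hk.ne', Nat.card_eq_fintype_card,
      FiniteField.pow_card_sub_one_eq_one x hx, map_one]
  obtain ⟨j, hj⟩ := (mem_powers_iff_mem_zpowers.mpr (hα (Units.mk0 _ hfx)) :
    Units.mk0 _ hfx ∈ Submonoid.powers α)
  have hj' : f x = (α : F) ^ j := by
    simpa using (congrArg Units.val hj).symm
  have hord : orderOf α = p ^ m - 1 := by
    rw [orderOf_eq_card_of_forall_mem_zpowers hα, Nat.card_eq_fintype_card, Fintype.card_units, hF]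
  -- The order `p ^ m - 1` of `α` divides `j * (p ^ k - 1)`; cancelling `p ^ k - 1` gives `4 ∣ j`.
  have hdvd2 : 4 * (p ^ k - 1) ∣ j * (p ^ k - 1) := by
    refine hdvd.trans ?_
    rw [← hord, orderOf_dvd_iff_pow_eq_one]
    ext
    push_cast
    rw [pow_mul, ← hj', hpow]
  obtain ⟨i, rfl⟩ := Nat.dvd_of_mul_dvd_mul_right
    (Nat.sub_pos_of_lt (Nat.one_lt_pow hk.ne' hp.one_lt)) hdvd2
  exact ⟨(α : F) ^ i, pow_ne_zero _ α.ne_zero, by rw [hj', ← pow_mul, mul_comm i]⟩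

/-- If `θ` generates a subfield of degree `d`, then `n ∣ p ^ d - 1`, and minimality of `m` gives `m
≤ d`. -/
theorem adjoin_eq_top_of_orderOf {m n : ℕ} (hF : Fintype.card F = p ^ m)
    (hm : ∀ k, 0 < k → p ^ k ≡ 1 [MOD n] → m ≤ k) {θ : F} (hθ0 : θ ≠ 0) (hθ : orderOf θ = n) :
    IntermediateField.adjoin (ZMod p) {θ} = ⊤ := by
  have hp := (Fact.out : p.Prime)
  set E := IntermediateField.adjoin (ZMod p) {θ}
  have := Fintype.ofFinite E
  have hcard : Fintype.card E = p ^ Module.finrank (ZMod p) E := by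
    rw [Module.card_eq_pow_finrank (K := ZMod p), ZMod.card]
  have hpow : θ ^ (p ^ Module.finrank (ZMod p) E - 1) = 1 := by
    have := FiniteField.pow_card_sub_one_eq_one
      (⟨θ, IntermediateField.mem_adjoin_simple_self _ θ⟩ : E) (by
        intro h
        exact hθ0 (congrArg Subtype.val h))
    rw [hcard] at this
    exact congrArg Subtype.val this
  rw [← orderOf_dvd_iff_pow_eq_one, hθ] at hpow
  have hle := hm _ Module.finrank_pos
    ((Nat.modEq_iff_dvd' (Nat.one_le_pow _ _ hp.pos)).mpr hpow).symm
  rw [← finrank_eq_of_card_eq hF] at hle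
  exact IntermediateField.eq_of_le_of_finrank_le le_top (by simpa using hle)

/-- The powers of `θ` span `F`, so a kernel element is orthogonal to all of `F` under the
nondegenerate trace form. -/
theorem traceWord_injective {n : ℕ} (hn : 0 < n) {θ : F} (hθ : orderOf θ = n)
    (htop : IntermediateField.adjoin (ZMod p) {θ} = ⊤) :
    Function.Injective (traceWord (ZMod p) fun i : Fin n => θ ^ (i : ℕ)) := by
  rw [← LinearMap.ker_eq_bot, LinearMap.ker_eq_bot']
  intro a ha
  have hpow (j : ℕ) : Algebra.trace (ZMod p) F (a * θ ^ j) = 0 := by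
    rw [← pow_mod_orderOf, hθ]
    exact congrFun ha ⟨j % n, Nat.mod_lt _ hn⟩
  have hpoly (f : Polynomial (ZMod p)) :
      Algebra.trace (ZMod p) F (a * Polynomial.aeval θ f) = 0 := by
    rw [Polynomial.aeval_eq_sum_range, Finset.mul_sum, map_sum]
    refine Finset.sum_eq_zero fun i _ => ?_
    rw [mul_smul_comm, map_smul, hpow, smul_zero]
  have hall (x : F) : Algebra.trace (ZMod p) F (a * x) = 0 := by
    have hx : x ∈ (IntermediateField.adjoin (ZMod p) {θ}).toSubalgebra := by
      rw [htop]
      trivial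
    rw [IntermediateField.adjoin_simple_toSubalgebra_of_isAlgebraic
      (Algebra.IsAlgebraic.isAlgebraic θ), Algebra.adjoin_singleton_eq_range_aeval] at hx
    obtain ⟨f, rfl⟩ := hx
    exact hpoly f
  by_contra ha0
  obtain ⟨y, hy⟩ := Algebra.trace_surjective (ZMod p) F 1
  have := hall (a⁻¹ * y)
  rw [mul_inv_cancel_left₀ ha0, hy] at this
  exact one_ne_zero this

end Dimension

/-! ### From the maximum of the quartic sum to the generalized weight -/

section GeneralizedWeight

variable {p : ℕ} [Fact p.Prime] {F : Type*} [Field F] [Algebra (ZMod p) F] [Fintype F]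

theorem generalizedHammingWeight_eq_of_isLeast {K ι : Type*} [Field K] {C : Submodule K (ι → K)}
    {r w : ℕ} (h : IsLeast {s : ℕ | ∃ U : Submodule K (ι → K),
      U ≤ C ∧ Module.finrank K U = r ∧ (codeSupport U).ncard = s} w) :
    generalizedHammingWeight C r = w :=
  h.csInf_eq

/-- If the quartic sums are integers at most `B` away from zero, and all equal to `B` on some
punctured `r`-dimensional subspace, then this subspace gives the `r`-th generalized weight. -/
theorem generalizedHammingWeight_eq_of_quarticSum_le {N n r : ℕ} (hn : 0 < N) {α : Fˣ}
    (hα : ∀ x, x ∈ Subgroup.zpowers α) (hN : N * n = Fintype.card F - 1)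
    (hgcd : Nat.gcd N ((Fintype.card F - 1) / (p - 1)) = 4)
    (hinj : Function.Injective
      (traceWord (ZMod p) fun i : Fin n => ((α : F) ^ N) ^ (i : ℕ)))
    {B : ℤ} (hB : ∀ a : F, a ≠ 0 → ∃ s : ℤ, quarticSum (traceChar p F) a = s ∧ s ≤ B)
    {H₀ : Submodule (ZMod p) F} (hr : Module.finrank (ZMod p) H₀ = r)
    (hH₀ : ∀ a ∈ H₀, a ≠ 0 → quarticSum (traceChar p F) a = B) :
    (generalizedHammingWeight
      (definingSetCode (ZMod p) (fun i : Fin n => ((α : F) ^ N) ^ (i : ℕ))) r : ℝ)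
      = (1 - 1 / (p : ℝ) ^ r) * ((Fintype.card F - B) / N) := by
  classical
  have hp := (Fact.out : p.Prime)
  have hint (a : F) : ∃ s : ℤ, quarticSum (traceChar p F) a = s ∧
      (a = 0 → s = Fintype.card F) ∧ (a ≠ 0 → s ≤ B) := by
    by_cases ha : a = 0
    · exact ⟨Fintype.card F, by simp [ha, quarticSum_zero], fun _ => rfl, fun h => absurd ha h⟩
    · obtain ⟨s, hs, hsB⟩ := hB a ha
      exact ⟨s, hs, fun h => absurd h ha, fun _ => hsB⟩
  choose t ht ht0 htB using hint
  set T := traceWord (ZMod p) fun i : Fin n => ((α : F) ^ N) ^ (i : ℕ)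
  have hcardH (H : Submodule (ZMod p) F) (hH : Module.finrank (ZMod p) H = r) :
      Fintype.card H = p ^ r := by
    rw [Module.card_eq_pow_finrank (K := ZMod p), ZMod.card, hH]
  have hweight (H : Submodule (ZMod p) F) (hH : Module.finrank (ZMod p) H = r) :
      (N : ℤ) * (p ^ r * (codeSupport (H.map T)).ncard)
        = p ^ r * Fintype.card F - ∑ a : H, t a := by
    have h := mul_card_mul_ncard_codeSupport hα hN hgcd H
    simp only [ht, hcardH H hH] at h
    exact_mod_cast h
  -- The defect from the extremal weight is a sum of terms `B - S(a)` over nonzero `a`: nonnegative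
  -- in general, zero for `H₀`.
  have hsplit (H : Submodule (ZMod p) F) (hH : Module.finrank (ZMod p) H = r) :
      Fintype.card F + (p ^ r - 1) * B - ∑ a : H, t a = ∑ a : H, if a = 0 then 0 else B - t a := by
    have h (a : H) : (if a = 0 then 0 else B - t a)
        = (if a = 0 then (Fintype.card F : ℤ) - B else 0) + B - t a := by
      split_ifs with ha
      · rw [ht0 a (by simp [ha])]
        ring
      · ring
    simp only [h, Finset.sum_sub_distrib, Finset.sum_add_distrib]
    simp [hcardH H hH]
    ring
  have hle (H : Submodule (ZMod p) F) (hH : Module.finrank (ZMod p) H = r) :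
      (p ^ r - 1) * (Fintype.card F - B) ≤ (N : ℤ) * (p ^ r * (codeSupport (H.map T)).ncard) := by
    have h1 : 0 ≤ ∑ a : H, if a = 0 then 0 else B - t a := by
      refine Finset.sum_nonneg fun a _ => ?_
      split_ifs with ha
      · rfl
      · exact sub_nonneg.mpr (htB a (by simpa using ha))
    rw [← hsplit H hH] at h1
    rw [hweight H hH]
    linarith
  have heq : (p ^ r - 1) * (Fintype.card F - B)
      = (N : ℤ) * (p ^ r * (codeSupport (H₀.map T)).ncard) := by
    have h1 : ∑ a : H₀, (if a = 0 then 0 else B - t a) = 0 := by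
      refine Finset.sum_eq_zero fun a _ => ?_
      split_ifs with ha
      · rfl
      · have h := hH₀ a a.2 (by simpa using ha)
        rw [ht] at h
        rw [Int.cast_injective h, sub_self]
    rw [← hsplit H₀ hr] at h1
    rw [hweight H₀ hr]
    linarith
  have hfin (H : Submodule (ZMod p) F) :
      Module.finrank (ZMod p) (H.map T) = Module.finrank (ZMod p) H :=
    (Submodule.equivMapOfInjective T hinj H).finrank_eq.symm
  have hpr : 0 < p ^ r := pow_pos hp.pos r
  rw [generalizedHammingWeight_eq_of_isLeast (w := (codeSupport (H₀.map T)).ncard)]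
  · have hR : ((p : ℝ) ^ r - 1) * (Fintype.card F - B)
        = N * (p ^ r * (codeSupport (H₀.map T)).ncard) := by exact_mod_cast heq
    have hpr' : (p : ℝ) ^ r ≠ 0 := by exact_mod_cast hpr.ne'
    have hN' : (N : ℝ) ≠ 0 := by exact_mod_cast hn.ne'
    field_simp
    linear_combination -hR
  · refine ⟨⟨_, LinearMap.map_le_range, by rw [hfin, hr], rfl⟩, ?_⟩
    rintro s ⟨U, hU, hUr, rfl⟩
    obtain ⟨H, rfl⟩ : ∃ H : Submodule (ZMod p) F, H.map T = U :=
      ⟨U.comap T, Submodule.map_comap_eq_of_le hU⟩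
    have h := heq ▸ hle H (by rw [← hfin, hUr])
    have h' : N * (p ^ r * (codeSupport (H₀.map T)).ncard)
        ≤ N * (p ^ r * (codeSupport (H.map T)).ncard) := by exact_mod_cast h
    exact Nat.le_of_mul_le_mul_left (Nat.le_of_mul_le_mul_left h' hn) hpr

end GeneralizedWeight

/-! ### Divisibility of `p ^ m - 1` and the final assembly -/

theorem eight_dvd_pow_two_mul_sub_one {p : ℕ} (hp : p % 4 = 3) (h : ℕ) : 8 ∣ p ^ (2 * h) - 1 := by
  have h1 : p ^ 2 ≡ 1 [MOD 8] := by
    have : p % 8 = 3 ∨ p % 8 = 7 := by omega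
    rcases this with h | h <;> simp [Nat.ModEq, Nat.pow_mod, h]
  have h2 : p ^ (2 * h) ≡ 1 [MOD 8] := by
    simpa [pow_mul] using h1.pow h
  exact (Nat.modEq_iff_dvd' (Nat.one_le_pow _ _ (by omega))).mp h2.symm

/-- For odd `h`, `4 ∣ p + 1 ∣ p ^ h + 1`. Hence the units of the subfield of order `p ^ h` are
fourth powers. -/
theorem four_mul_dvd_pow_two_mul_sub_one {p h : ℕ} (hp : p % 4 = 3) (hh : Odd h) :
    4 * (p ^ h - 1) ∣ p ^ (2 * h) - 1 := by
  have h1 : 4 ∣ p ^ h + 1 := by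
    simpa using (show 4 ∣ p + 1 by omega).trans (by simpa using hh.nat_add_dvd_pow_add_pow p 1)
  rw [mul_comm 2, pow_mul, ← one_pow 2, Nat.sq_sub_sq, one_pow]
  exact mul_dvd_mul_right h1 _

/-- Here the factor `4` comes from the two even numbers `p ^ k + 1` and `p ^ (2k) + 1`. -/
theorem four_mul_dvd_pow_four_mul_sub_one {p : ℕ} (hp : p % 4 = 3) (k : ℕ) :
    4 * (p ^ k - 1) ∣ p ^ (4 * k) - 1 := by
  have hodd : Odd p := Nat.odd_iff.mpr (by omega)
  have h1 : 2 ∣ p ^ k + 1 := (hodd.pow.add_odd odd_one).two_dvd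
  have h2 : 2 ∣ p ^ (k * 2) + 1 := (hodd.pow.add_odd odd_one).two_dvd
  have h3 : p ^ (4 * k) - 1 = (p ^ (k * 2) + 1) * ((p ^ k + 1) * (p ^ k - 1)) := by
    have e1 := Nat.sq_sub_sq (p ^ k) 1
    have e2 := Nat.sq_sub_sq (p ^ (k * 2)) 1
    rw [one_pow, ← pow_mul] at e1 e2
    rw [← e1, ← e2]
    congr 2
    ring
  rw [h3, ← mul_assoc]
  exact mul_dvd_mul_right (mul_dvd_mul h2 h1) _

theorem mainTheorem12
    (p m n₁ N : ℕ) [Fact p.Prime] (hp : p % 4 = 3)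
    (hn₁ : 0 < n₁) (hcop : Nat.Coprime n₁ p)
    (hm : IsLeast {k : ℕ | 0 < k ∧ p ^ k ≡ 1 [MOD n₁]} m)
    (F : Type*) [Field F] [Fintype F] [Algebra (ZMod p) F] (hF : Fintype.card F = p ^ m)
    (α : Fˣ) (hα : ∀ x : Fˣ, x ∈ Subgroup.zpowers α)
    (hN : N * n₁ = p ^ m - 1)
    (hN₁ : Nat.gcd N ((p ^ m - 1) / (p - 1)) = 4)
    (θ : F) (hθ : θ = (α : F) ^ N) :
    (m % 4 = 2 → ∀ r : ℕ, 1 ≤ r → 2 * r ≤ m →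
      (generalizedHammingWeight
          (definingSetCode (ZMod p) (fun i : Fin n₁ => θ ^ (i : ℕ))) r : ℝ) =
        (1 - 1 / (p : ℝ) ^ r) * (((p : ℝ) ^ m - 3 * Real.sqrt ((p : ℝ) ^ m)) / (N : ℝ))) ∧
    (m % 4 = 0 → ∀ r : ℕ, 1 ≤ r → 4 * r ≤ m →
      (generalizedHammingWeight
          (definingSetCode (ZMod p) (fun i : Fin n₁ => θ ^ (i : ℕ))) r : ℝ) =
        (1 - 1 / (p : ℝ) ^ r) * (((p : ℝ) ^ m - Real.sqrt ((p : ℝ) ^ m)) / (N : ℝ))) := by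
  classical
  subst hθ
  have hprime := (Fact.out : p.Prime)
  have hm0 : 0 < m := hm.1.1
  have hq : 0 < p ^ m - 1 := Nat.sub_pos_of_lt (Nat.one_lt_pow hm0.ne' hprime.one_lt)
  have hN0 : 0 < N := Nat.pos_of_mul_pos_right (hN ▸ hq)
  have hcardU : Fintype.card Fˣ = p ^ m - 1 := by rw [Fintype.card_units, hF]
  have hord : orderOf ((α : F) ^ N) = n₁ := by
    rw [← Units.val_pow_eq_pow_val, orderOf_units, orderOf_pow,
      orderOf_eq_card_of_forall_mem_zpowers hα, Nat.card_eq_fintype_card, hcardU, ← hN,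
      Nat.gcd_mul_right_left, Nat.mul_div_cancel_left _ hN0]
  have hinj := traceWord_injective hn₁ hord (adjoin_eq_top_of_orderOf hF
    (fun k hk hk' => hm.2 ⟨hk, hk'⟩) (pow_ne_zero _ α.ne_zero) hord)
  have : CharP F p := charP_of_injective_algebraMap (algebraMap (ZMod p) F).injective p
  have hsqrt (h : ℕ) : Real.sqrt ((p : ℝ) ^ (2 * h)) = (p : ℝ) ^ h := by
    rw [mul_comm, pow_mul, Real.sqrt_sq (by positivity)]
  have hvalues (h : ℕ) (hmh : m = 2 * h) :=
    quarticSum_values p hp (traceChar_isPrimitive (p := p) (F := F)) traceChar_pow hα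
      (by rw [hcardU, hmh]; exact eight_dvd_pow_two_mul_sub_one hp h) (hmh ▸ hF)
  have hmain {r k : ℕ} {c : F} {B : ℤ} (hc : c ≠ 0) (hcB : quarticSum (traceChar p F) c = B)
      (hB : ∀ a : F, a ≠ 0 → ∃ s : ℤ, quarticSum (traceChar p F) a = s ∧ s ≤ B)
      (hk : 0 < k) (hkm : k ∣ m) (hdvd : 4 * (p ^ k - 1) ∣ p ^ m - 1) (hr : r ≤ k) :
      (generalizedHammingWeight
        (definingSetCode (ZMod p) (fun i : Fin n₁ => ((α : F) ^ N) ^ (i : ℕ))) r : ℝ)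
        = (1 - 1 / (p : ℝ) ^ r) * (((p : ℝ) ^ m - B) / N) := by
    obtain ⟨H, hH, hHc⟩ := exists_submodule_subset_coset_pow_four hF hk hkm hdvd hα hc hr
    have := generalizedHammingWeight_eq_of_quarticSum_le hN0 hα (by rw [hF, hN])
      (by rw [hF, hN₁]) hinj hB hH fun a ha ha0 => by
        obtain ⟨y, hy, rfl⟩ := hHc a ha ha0
        rw [quarticSum_mul_pow_four _ hy, hcB]
    rw [this, hF]
    push_cast
    rfl
  constructor
  · intro hm4 r _ hr
    obtain ⟨h, rfl⟩ : ∃ h, m = 2 * h := ⟨m / 2, by omega⟩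
    have hodd : Odd h := Nat.odd_iff.mpr (by omega)
    obtain ⟨-, ⟨c, hc, hcS⟩, hS⟩ := hvalues h rfl
    -- For odd `h`, `ε = -p ^ h`, so the maximum is `-3ε = 3 p ^ h`, attained on the coset of `c`.
    rw [hodd.neg_pow] at hcS hS
    have hpos : 0 < (p : ℤ) ^ h := pow_pos (by exact_mod_cast hprime.pos) h
    rw [hmain hc hcS (fun a ha => (hS a ha).elim (fun e => ⟨_, e, by linarith⟩)
      fun e => ⟨_, e, le_rfl⟩) (by omega) (Dvd.intro_left 2 rfl)
      (four_mul_dvd_pow_two_mul_sub_one hp hodd) (by omega), hsqrt]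
    push_cast
    ring
  · intro hm4 r _ hr
    obtain ⟨k, rfl⟩ : ∃ k, m = 4 * k := ⟨m / 4, by omega⟩
    have hmk : 4 * k = 2 * (2 * k) := by ring
    obtain ⟨hαS, -, hS⟩ := hvalues (2 * k) hmk
    -- Now `ε = p ^ (2k)` is positive and is itself the maximum, attained on the coset of `α`.
    rw [(even_two_mul k).neg_pow] at hαS hS
    have hpos : 0 < (p : ℤ) ^ (2 * k) := pow_pos (by exact_mod_cast hprime.pos) _
    rw [hmain α.ne_zero hαS (fun a ha => (hS a ha).elim (fun e => ⟨_, e, le_rfl⟩)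
      fun e => ⟨_, e, by linarith⟩) (by omega) (Dvd.intro_left 4 rfl)
      (four_mul_dvd_pow_four_mul_sub_one hp k) (by omega), hmk, hsqrt]
    push_cast
    ring
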